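/- Let $X$ be a non-empty set and let $\mathcal L$ be the real vector space of all gambles on $X$, i.e. of all bounded maps $f\colon X\to\mathbb R$; real numbers are identified with constant gambles. Let $\mathcal Q$ be the set of all finite subsets of $\mathcal L$, including $\emptyset$, and write $(\lambda,\mu)>0$ for: $\lambda\ge 0$, $\mu\ge 0$ and $\lambda+\mu>0$. A set $D\subseteq\mathcal L$ is called an Archimedean set of desirable options if $0\notin D$; every $f\in\mathcal L$ with $\inf f>0$ is in $D$; $\lambda f+\mu g\in D$ for all $f,g\in D$ and all $(\lambda,\mu)>0$; and for every $f\in D$ there is a real $\epsilon>0$ with $f-\epsilon\in D$. Let $\overline{\mathbf D}_{\mathrm A}$ be the set of all such $D$. With $D\in\overline{\mathbf D}_{\mathrm A}$ associate the coherent lower prevision $\underline P_D\colon\mathcal L\to\mathbb R$, $\underline P_D(f)=\sup\{\mu\in\mathbb R: f-\mu\in D\}$, and the set $K_D=\{A\in\mathcal Q: A\cap D\neq\emptyset\}$. Give $\overline{\mathbf D}_{\mathrm A}$ the topology of pointwise convergence of the associated lower previsions, that is, the topology induced by the map $D\mapsto\underline P_D$ into $\mathbb R^{\mathcal L}$ with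 the product topology. A set $K\subseteq\mathcal Q$ is called coherent if - $A\setminus\{0\}\in K$ for all $A\in K$; - $\{0\}\notin K$; - $\{f\}\in K$ for all $f\in\mathcal L$ with $\inf f>0$; - for all $A_1,A_2\in K$ and all choices of $(\lambda_{f,g},\mu_{f,g})>0$ for $f\in A_1$, $g\in A_2$, also $\{\lambda_{f,g}f+\mu_{f,g}g: f\in A_1,\ g\in A_2\}\in K$; - if $A_1\in K$, $A_2\in\mathcal Q$ and $A_1\subseteq A_2$, then $A_2\in K$. It is called Archimedean if it is coherent and for every $A\in K$ there is a real $\epsilon>0$ with $A-\epsilon=\{f-\epsilon: f\in A\}\in K$. Theorem. A set $K\subseteq\mathcal Q$ is Archimedean if and only if there is a non-empty closed set $\mathcal D\subseteq\overline{\mathbf D}_{\mathrm A}$ such that $K=\bigcap_{D\in\mathcal D}K_D$. In that case, $\{D\in\overline{\mathbf D}_{\mathrm A}: K\subseteq K_D\}$ is the largest such set $\mathcal D$: it is non-empty and closed, it satisfies $K=\bigcap_{D\in\mathcal D}K_D$, and it includes every other such set. -/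

import Mathlib

/-- The real vector space of all gambles on `X`, i.e. of all bounded real-valued maps on `X`. -/
def gambleSpace (X : Type*) : Submodule ℝ (X → ℝ) where
  carrier := {f | ∃ C : ℝ, ∀ x, |f x| ≤ C}
  add_mem' := by
    rintro f g ⟨C, hC⟩ ⟨C', hC'⟩
    exact ⟨C + C', fun x => (abs_add_le _ _).trans (add_le_add (hC x) (hC' x))⟩
  zero_mem' := ⟨0, fun x => by simp⟩
  smul_mem' := by
    rintro c f ⟨C, hC⟩
    refine ⟨|c| * C, fun x => ?_⟩
    simpa [abs_mul] using mul_le_mul_of_nonneg_left (hC x) (abs_nonneg c)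

/-- A gamble on `X`; gambles are the options. -/
abbrev Gamble (X : Type*) : Type _ := ↥(gambleSpace X)

/-- The constant gamble that a real number is identified with. -/
def constGamble (X : Type*) (c : ℝ) : Gamble X := ⟨fun _ => c, |c|, fun _ => le_rfl⟩

/-- The positive options: the gambles `f` with `inf f > 0`. -/
def positiveGambles (X : Type*) : Set (Gamble X) := {f | 0 < ⨅ x, f.1 x}

/-- The relation `(l, m) > 0` for pairs of real numbers: `l ≥ 0`, `m ≥ 0` and `l + m > 0`. -/
def PosPair (l m : ℝ) : Prop := 0 ≤ l ∧ 0 ≤ m ∧ 0 < l + m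

/-- Coherence for a set of desirable options. -/
structure IsCoherentOptions {X : Type*} (D : Set (Gamble X)) : Prop where
  zero_notMem : (0 : Gamble X) ∉ D
  pos_subset : positiveGambles X ⊆ D
  cone : ∀ f ∈ D, ∀ g ∈ D, ∀ l m : ℝ, PosPair l m → l • f + m • g ∈ D

/-- An Archimedean set of desirable options: coherent, and satisfying the openness condition. -/
structure IsArchimedeanOptions {X : Type*} (D : Set (Gamble X)) : Prop where
  coherent : IsCoherentOptions D
  arch : ∀ f ∈ D, ∃ ε : ℝ, 0 < ε ∧ f - constGamble X ε ∈ D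

open Classical in
/-- Coherence for a set of desirable option sets. An option set is a finite (possibly empty) set
of options. -/
structure IsCoherentOptionSets {X : Type*} (K : Set (Finset (Gamble X))) : Prop where
  erase_zero : ∀ A ∈ K, A.erase 0 ∈ K
  zero_notMem : ({0} : Finset (Gamble X)) ∉ K
  pos : ∀ f ∈ positiveGambles X, ({f} : Finset (Gamble X)) ∈ K
  cone : ∀ A₁ ∈ K, ∀ A₂ ∈ K, ∀ l m : Gamble X → Gamble X → ℝ,
    (∀ f ∈ A₁, ∀ g ∈ A₂, PosPair (l f g) (m f g)) →
      (A₁ ×ˢ A₂).image (fun p => l p.1 p.2 • p.1 + m p.1 p.2 • p.2) ∈ K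
  mono : ∀ A₁ ∈ K, ∀ A₂ : Finset (Gamble X), A₁ ⊆ A₂ → A₂ ∈ K

open Classical in
/-- An Archimedean set of desirable option sets: coherent, and for each `A` in `K` there is some
`ε > 0` such that `A - ε = {f - ε | f ∈ A}` is in `K`. -/
structure IsArchimedeanOptionSets {X : Type*} (K : Set (Finset (Gamble X))) : Prop where
  coherent : IsCoherentOptionSets K
  arch : ∀ A ∈ K, ∃ ε : ℝ, 0 < ε ∧ A.image (fun f => f - constGamble X ε) ∈ K

/-- The set of desirable option sets `K_D` associated with a set of desirable options `D`. -/
def optionSetsOf {X : Type*} (D : Set (Gamble X)) : Set (Finset (Gamble X)) :=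
  {A | ∃ f ∈ A, f ∈ D}

/-- The functional `P_D(f) = sup {μ | f - μ ∈ D}` associated with `D`. It is used for Archimedean
`D` only, where the supremum is a real number by `isLUB_lowerPrevision`. -/
noncomputable def lowerPrevision {X : Type*} (D : Set (Gamble X)) (f : Gamble X) : ℝ :=
  sSup {μ : ℝ | f - constGamble X μ ∈ D}

theorem isLUB_lowerPrevision {X : Type*} [Nonempty X] {D : Set (Gamble X)}
    (hD : IsArchimedeanOptions D) (f : Gamble X) :
    IsLUB {μ : ℝ | f - constGamble X μ ∈ D} (lowerPrevision D f) := by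
  obtain ⟨C, hC⟩ := f.2
  refine isLUB_csSup ⟨-C - 1, hD.coherent.pos_subset ?_⟩ ⟨C + 1, fun μ hμ => ?_⟩
  · change (0 : ℝ) < _
    refine lt_of_lt_of_le one_pos (le_ciInf fun x => ?_)
    have := (abs_le.1 (hC x)).1
    change 1 ≤ f.1 x - (-C - 1)
    linarith
  · by_contra! h
    have hp : constGamble X μ - f ∈ positiveGambles X := by
      change (0 : ℝ) < _
      refine lt_of_lt_of_le one_pos (le_ciInf fun x => ?_)
      have := (abs_le.1 (hC x)).2
      change 1 ≤ μ - f.1 x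
      linarith
    have h0 := hD.coherent.cone _ hμ _ (hD.coherent.pos_subset hp) 1 1
      ⟨zero_le_one, zero_le_one, by norm_num⟩
    exact hD.coherent.zero_notMem (by simpa using h0)

/-- The type of all Archimedean sets of desirable options. -/
structure ArchimedeanOptions (X : Type*) where
  carrier : Set (Gamble X)
  isArchimedean : IsArchimedeanOptions carrier

/-- The topology on Archimedean sets of desirable options given by pointwise convergence of the
associated lower previsions. -/
noncomputable instance ArchimedeanOptions.topology (X : Type*) : TopologicalSpace (ArchimedeanOptions X) :=
  TopologicalSpace.induced (fun D => lowerPrevision D.carrier) Pi.topologicalSpace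

theorem ArchimedeanOptions.tendsto_iff {X ι : Type*} (D : ι → ArchimedeanOptions X)
    (E : ArchimedeanOptions X) (u : Filter ι) :
    Filter.Tendsto D u (nhds E) ↔ ∀ f : Gamble X,
      Filter.Tendsto (fun i => lowerPrevision (D i).carrier f) u
        (nhds (lowerPrevision E.carrier f)) := by
  rw [nhds_induced, Filter.tendsto_comap_iff, tendsto_pi_nhds]
  rfl

/-- The family `𝒟` of Archimedean sets of desirable options represents `K`: it is non-empty, closed,
and `K` is the intersection of the `K_D`, for `D` in `𝒟`. -/
def IsClosedRepresentation {X : Type*} (K : Set (Finset (Gamble X)))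
    (𝒟 : Set (ArchimedeanOptions X)) : Prop :=
  𝒟.Nonempty ∧ IsClosed 𝒟 ∧ K = ⋂ D ∈ 𝒟, optionSetsOf D.carrier

/-!
Separating a coherent `K` from an option set `B ∉ K` is the heart of the matter. Enlarge the cone of
non-negative gambles by one element from each of finitely many option sets in `K`. If every choice
of an element of `A ∈ K` forced an option in `B ∪ {0}` into the interior of the cone, then combining
these failures by the cone axiom would put `B` itself in `K`; so suitable choices exist, and the
interior of the resulting cone is an Archimedean set of desirable options that avoids `B`.

The coherent lower previsions form a closed subset of a product of compact intervals, so the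
Archimedean sets of desirable options form a compact space, and compactness extends the separation
to all of `K` at once. In the limit a positive lower prevision on `A` may only be non-negative, but
for Archimedean `K` this weak inequality for all `A` in `K` implies the strict one, as it applies to
`A - ε` as well; this also makes `{D | K ⊆ K_D}` closed. Conversely, on a compact family the maximum
over `A` of the lower previsions is bounded away from `0`, which gives the `ε` for `A`.
-/

section Cones

theorem mem_sup_hull_singleton_iff {R E : Type*} [Semiring R] [PartialOrder R] [IsOrderedRing R]
    [AddCommMonoid E] [Module R E] {P : PointedCone R E} {f x : E} :
    x ∈ P ⊔ PointedCone.hull R {f} ↔ ∃ p ∈ P, ∃ l : R, 0 ≤ l ∧ p + l • f = x := by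
  simp only [Submodule.mem_sup, Submodule.mem_span_singleton, Subtype.exists]
  constructor
  · rintro ⟨p, hp, _, ⟨l, hl, rfl⟩, rfl⟩
    exact ⟨p, hp, l, hl, rfl⟩
  · rintro ⟨p, hp, l, hl, rfl⟩
    exact ⟨p, hp, _, ⟨l, hl, rfl⟩, rfl⟩

theorem exists_posPair_mem_sup_hull_singleton {E : Type*} [AddCommMonoid E] [Module ℝ E]
    {P : PointedCone ℝ E} {f g x : E}
    (hx : x ∈ P ⊔ PointedCone.hull ℝ {f} ⊔ PointedCone.hull ℝ {g}) :
    ∃ l m : ℝ, PosPair l m ∧ x ∈ P ⊔ PointedCone.hull ℝ {l • f + m • g} := by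
  obtain ⟨_, hy, m, hm, rfl⟩ := mem_sup_hull_singleton_iff.1 hx
  obtain ⟨p, hp, l, hl, rfl⟩ := mem_sup_hull_singleton_iff.1 hy
  rcases (add_nonneg hl hm).eq_or_lt with hlm | hlm
  · obtain rfl : l = 0 := by linarith
    obtain rfl : m = 0 := by linarith
    exact ⟨1, 0, ⟨zero_le_one, le_rfl, by norm_num⟩, Submodule.mem_sup_left (by simpa using hp)⟩
  · refine ⟨l, m, ⟨hl, hm, hlm⟩, mem_sup_hull_singleton_iff.2 ⟨p, hp, 1, zero_le_one, ?_⟩⟩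
    rw [one_smul, add_assoc]

end Cones

section Gambles

variable {X : Type*}

theorem constGamble_add (a b : ℝ) :
    constGamble X (a + b) = constGamble X a + constGamble X b := rfl

theorem constGamble_sub (a b : ℝ) :
    constGamble X (a - b) = constGamble X a - constGamble X b := rfl

theorem constGamble_neg (a : ℝ) : constGamble X (-a) = -constGamble X a := rfl

theorem constGamble_mul (a b : ℝ) : constGamble X (a * b) = a • constGamble X b := rfl

theorem constGamble_zero : constGamble X 0 = 0 := rfl

instance posSMulMono_gamble : PosSMulMono ℝ (Gamble X) where
  smul_le_smul_of_nonneg_left _ hc _ _ hfg x := mul_le_mul_of_nonneg_left (hfg x) hc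

theorem bddBelow_range_gamble (f : Gamble X) : BddBelow (Set.range f.1) := by
  obtain ⟨C, hC⟩ := f.2
  exact ⟨-C, Set.forall_mem_range.2 fun x => (abs_le.1 (hC x)).1⟩

theorem constGamble_iInf_le (f : Gamble X) : constGamble X (⨅ x, f.1 x) ≤ f :=
  ciInf_le (bddBelow_range_gamble f)

theorem iInf_constGamble [Nonempty X] (c : ℝ) : ⨅ x, (constGamble X c).1 x = c :=
  ciInf_const

theorem sub_constGamble_mem_positiveGambles_iff [Nonempty X] {f : Gamble X} {c : ℝ} :
    f - constGamble X c ∈ positiveGambles X ↔ c < ⨅ x, f.1 x := by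
  change 0 < ⨅ x, (f.1 x - c) ↔ _
  rw [← ciInf_sub (bddBelow_range_gamble f), sub_pos]

theorem constGamble_mem_positiveGambles [Nonempty X] {c : ℝ} (hc : 0 < c) :
    constGamble X c ∈ positiveGambles X :=
  hc.trans_eq (iInf_constGamble c).symm

theorem add_constGamble_mem_positiveGambles [Nonempty X] {f : Gamble X} (hf : 0 ≤ f) {c : ℝ}
    (hc : 0 < c) : f + constGamble X c ∈ positiveGambles X :=
  hc.trans_le (le_ciInf fun x => le_add_of_nonneg_left (hf x))

end Gambles

section CoherentOptions

variable {X : Type*} {D : Set (Gamble X)}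

theorem IsCoherentOptions.add_mem (hD : IsCoherentOptions D) {f g : Gamble X} (hf : f ∈ D)
    (hg : g ∈ D) : f + g ∈ D := by
  simpa using hD.cone f hf g hg 1 1 ⟨zero_le_one, zero_le_one, by norm_num⟩

theorem IsCoherentOptions.smul_mem (hD : IsCoherentOptions D) {f : Gamble X} (hf : f ∈ D) {c : ℝ}
    (hc : 0 < c) : c • f ∈ D := by
  simpa using hD.cone f hf f hf c 0 ⟨hc.le, le_rfl, by simpa using hc⟩

theorem IsCoherentOptions.smul_mem_iff (hD : IsCoherentOptions D) {f : Gamble X} {c : ℝ}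
    (hc : 0 < c) : c • f ∈ D ↔ f ∈ D := by
  refine ⟨fun h => ?_, fun h => hD.smul_mem h hc⟩
  simpa [smul_smul, hc.ne'] using hD.smul_mem h (inv_pos.2 hc)

open Classical in
theorem IsCoherentOptions.isCoherentOptionSets_optionSetsOf (hD : IsCoherentOptions D) :
    IsCoherentOptionSets (optionSetsOf D) where
  erase_zero := by
    rintro A ⟨f, hfA, hf⟩
    exact ⟨f, Finset.mem_erase.2 ⟨fun h => hD.zero_notMem (h ▸ hf), hfA⟩, hf⟩
  zero_notMem := by
    rintro ⟨f, hfA, hf⟩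
    exact hD.zero_notMem (Finset.mem_singleton.1 hfA ▸ hf)
  pos f hf := ⟨f, Finset.mem_singleton_self f, hD.pos_subset hf⟩
  cone := by
    rintro A₁ ⟨f, hfA, hf⟩ A₂ ⟨g, hgA, hg⟩ l m h
    exact ⟨_, Finset.mem_image.2 ⟨(f, g), Finset.mem_product.2 ⟨hfA, hgA⟩, rfl⟩,
      hD.cone f hf g hg _ _ (h f hfA g hgA)⟩
  mono := by
    rintro A₁ ⟨f, hfA, hf⟩ A₂ h
    exact ⟨f, h hfA, hf⟩

end CoherentOptions

section LowerPrevisions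

variable {X : Type*}

/-- A coherent lower prevision: a superadditive, positively homogeneous functional on gambles that
dominates the infimum. These are exactly the functionals associated with Archimedean sets of
desirable options. -/
structure IsCoherentLowerPrevision (P : Gamble X → ℝ) : Prop where
  iInf_le : ∀ f : Gamble X, ⨅ x, f.1 x ≤ P f
  add_le : ∀ f g : Gamble X, P f + P g ≤ P (f + g)
  smul : ∀ (f : Gamble X) (c : ℝ), 0 < c → P (c • f) = c * P f

theorem isClosed_setOf_isCoherentLowerPrevision :
    IsClosed {P : Gamble X → ℝ | IsCoherentLowerPrevision P} := by
  have hinter : {P : Gamble X → ℝ | IsCoherentLowerPrevision P} =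
      {P | ∀ f : Gamble X, ⨅ x, f.1 x ≤ P f} ∩ ({P | ∀ f g : Gamble X, P f + P g ≤ P (f + g)} ∩
        {P | ∀ (f : Gamble X) (c : ℝ), 0 < c → P (c • f) = c * P f}) :=
    Set.ext fun P => ⟨fun h => ⟨h.1, h.2, h.3⟩, fun h => ⟨h.1, h.2.1, h.2.2⟩⟩
  simp only [hinter, Set.ofPred_forall]
  refine .inter ?_ (.inter ?_ ?_)
  · exact isClosed_iInter fun f => isClosed_le continuous_const (continuous_apply f)
  · exact isClosed_iInter fun f => isClosed_iInter fun g =>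
      isClosed_le (by fun_prop) (continuous_apply _)
  · exact isClosed_iInter fun f => isClosed_iInter fun c => isClosed_iInter fun _ =>
      isClosed_eq (continuous_apply _) (by fun_prop)

namespace IsCoherentLowerPrevision

variable {P : Gamble X → ℝ}

theorem map_zero (hP : IsCoherentLowerPrevision P) : P 0 = 0 := by
  have := hP.smul 0 2 two_pos
  rw [smul_zero] at this
  linarith

theorem le_neg_iInf_neg (hP : IsCoherentLowerPrevision P) (f : Gamble X) :
    P f ≤ -⨅ x, (-f).1 x := by
  have hadd := hP.add_le f (-f)
  have hneg := hP.iInf_le (-f)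
  rw [add_neg_cancel, hP.map_zero] at hadd
  linarith

theorem add_const_le [Nonempty X] (hP : IsCoherentLowerPrevision P) (f : Gamble X) (c : ℝ) :
    P f + c ≤ P (f + constGamble X c) :=
  calc P f + c = P f + ⨅ x, (constGamble X c).1 x := by rw [iInf_constGamble]
    _ ≤ P f + P (constGamble X c) := by gcongr; exact hP.iInf_le _
    _ ≤ P (f + constGamble X c) := hP.add_le _ _

theorem map_sub_const [Nonempty X] (hP : IsCoherentLowerPrevision P) (f : Gamble X) (c : ℝ) :
    P (f - constGamble X c) = P f - c := by
  have hge := hP.add_const_le f (-c)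
  have hle := hP.add_const_le (f - constGamble X c) c
  rw [constGamble_neg, ← sub_eq_add_neg, ← sub_eq_add_neg] at hge
  rw [sub_add_cancel] at hle
  linarith

theorem isArchimedeanOptions [Nonempty X] (hP : IsCoherentLowerPrevision P) :
    IsArchimedeanOptions {f | 0 < P f} where
  coherent :=
    { zero_notMem := fun h => h.ne' hP.map_zero
      pos_subset := fun f hf => hf.trans_le (hP.iInf_le f)
      cone := by
        rintro f (hf : 0 < P f) g (hg : 0 < P g) l m ⟨hl, hm, hlm⟩
        change 0 < P _
        rcases hl.eq_or_lt with rfl | hl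
        · rw [zero_add] at hlm
          rw [zero_smul, zero_add, hP.smul _ _ hlm]
          positivity
        rcases hm.eq_or_lt with rfl | hm
        · rw [zero_smul, add_zero, hP.smul _ _ hl]
          positivity
        · refine lt_of_lt_of_le ?_ (hP.add_le _ _)
          rw [hP.smul _ _ hl, hP.smul _ _ hm]
          positivity }
  arch f hf := ⟨P f / 2, half_pos hf, by
    rw [Set.mem_ofPred_eq, hP.map_sub_const, sub_half]
    exact half_pos hf⟩

theorem lowerPrevision_eq [Nonempty X] (hP : IsCoherentLowerPrevision P) :
    lowerPrevision {f | 0 < P f} = P := by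
  funext f
  simp only [lowerPrevision, Set.mem_ofPred_eq, hP.map_sub_const, sub_pos]
  exact csSup_Iio

end IsCoherentLowerPrevision

namespace IsArchimedeanOptions

variable [Nonempty X] {D : Set (Gamble X)}

theorem lt_lowerPrevision_iff (hD : IsArchimedeanOptions D) {f : Gamble X} {c : ℝ} :
    c < lowerPrevision D f ↔ f - constGamble X c ∈ D := by
  have hlub := isLUB_lowerPrevision hD f
  constructor
  · intro h
    obtain ⟨μ, hμ, hcμ⟩ := (lt_isLUB_iff hlub).1 h
    have hadd := hD.coherent.add_mem hμ
      (hD.coherent.pos_subset (constGamble_mem_positiveGambles (sub_pos.2 hcμ)))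
    simpa only [constGamble_sub, sub_add_sub_cancel] using hadd
  · intro h
    obtain ⟨ε, hε, hf⟩ := hD.arch _ h
    rw [sub_sub, ← constGamble_add] at hf
    exact (lt_add_of_pos_right c hε).trans_le (hlub.1 hf)

theorem lowerPrevision_pos_iff (hD : IsArchimedeanOptions D) {f : Gamble X} :
    0 < lowerPrevision D f ↔ f ∈ D := by
  rw [hD.lt_lowerPrevision_iff, constGamble_zero, sub_zero]

theorem isCoherentLowerPrevision (hD : IsArchimedeanOptions D) :
    IsCoherentLowerPrevision (lowerPrevision D) where
  iInf_le f := le_of_forall_lt fun _ ha => hD.lt_lowerPrevision_iff.2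
    (hD.coherent.pos_subset (sub_constGamble_mem_positiveGambles_iff.2 ha))
  add_le f g := by
    refine le_of_forall_lt fun a ha => ?_
    obtain ⟨b, hb, c, hc, rfl⟩ : ∃ b < lowerPrevision D f, ∃ c < lowerPrevision D g, b + c = a :=
      ⟨(a + lowerPrevision D f - lowerPrevision D g) / 2, by linarith,
        (a + lowerPrevision D g - lowerPrevision D f) / 2, by linarith, by ring⟩
    rw [hD.lt_lowerPrevision_iff] at hb hc ⊢
    rw [constGamble_add, add_sub_add_comm]
    exact hD.coherent.add_mem hb hc
  smul f c hc := eq_of_forall_lt_iff fun a => by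
    rw [hD.lt_lowerPrevision_iff, ← div_lt_iff₀' hc, hD.lt_lowerPrevision_iff,
      ← hD.coherent.smul_mem_iff hc (f := f - _), smul_sub, ← constGamble_mul,
      mul_div_cancel₀ _ hc.ne']

end IsArchimedeanOptions

end LowerPrevisions

namespace ArchimedeanOptions

variable {X : Type*}

theorem isInducing_lowerPrevision :
    Topology.IsInducing fun D : ArchimedeanOptions X => lowerPrevision D.carrier := ⟨rfl⟩

theorem continuous_lowerPrevision (f : Gamble X) :
    Continuous fun D : ArchimedeanOptions X => lowerPrevision D.carrier f :=
  (continuous_apply f).comp isInducing_lowerPrevision.continuous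

/-- The Archimedean sets of desirable options whose lower prevision is non-negative somewhere on
`A`. This is a closed relaxation of `A ∈ optionSetsOf D.carrier`, which requires a positive value;
an Archimedean `K` does not notice the difference. -/
def weaklyAccepting (A : Finset (Gamble X)) : Set (ArchimedeanOptions X) :=
  {D | ∃ f ∈ A, 0 ≤ lowerPrevision D.carrier f}

theorem isClosed_weaklyAccepting (A : Finset (Gamble X)) : IsClosed (weaklyAccepting A) := by
  have : weaklyAccepting A =
      ⋃ f ∈ A, {D : ArchimedeanOptions X | 0 ≤ lowerPrevision D.carrier f} := by
    ext D
    simp [weaklyAccepting]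
  rw [this]
  exact A.finite_toSet.isClosed_biUnion fun f _ =>
    isClosed_le continuous_const (continuous_lowerPrevision f)

section Nonempty

variable [Nonempty X]

theorem range_lowerPrevision :
    Set.range (fun D : ArchimedeanOptions X => lowerPrevision D.carrier) =
      {P | IsCoherentLowerPrevision P} := by
  refine Set.Subset.antisymm ?_ fun P hP => ⟨⟨_, hP.isArchimedeanOptions⟩, hP.lowerPrevision_eq⟩
  rintro _ ⟨D, rfl⟩
  exact D.isArchimedean.isCoherentLowerPrevision

instance compactSpace : CompactSpace (ArchimedeanOptions X) := by
  refine ⟨isInducing_lowerPrevision.isCompact_iff.2 ?_⟩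
  rw [Set.image_univ, range_lowerPrevision]
  exact (isCompact_univ_pi fun f : Gamble X =>
    isCompact_Icc (a := ⨅ x, f.1 x) (b := -⨅ x, (-f).1 x)).of_isClosed_subset
      isClosed_setOf_isCoherentLowerPrevision fun P hP f _ => ⟨hP.iInf_le f, hP.le_neg_iInf_neg f⟩

theorem mem_optionSetsOf_iff_lowerPrevision_pos {D : ArchimedeanOptions X}
    {A : Finset (Gamble X)} :
    A ∈ optionSetsOf D.carrier ↔ ∃ f ∈ A, 0 < lowerPrevision D.carrier f := by
  simp only [D.isArchimedean.lowerPrevision_pos_iff]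
  rfl

theorem isClosed_setOf_notMem_optionSetsOf (B : Finset (Gamble X)) :
    IsClosed {D : ArchimedeanOptions X | B ∉ optionSetsOf D.carrier} := by
  simp only [mem_optionSetsOf_iff_lowerPrevision_pos, not_exists, not_and, not_lt,
    Set.ofPred_forall]
  exact isClosed_biInter fun f _ => isClosed_le (continuous_lowerPrevision f) continuous_const

theorem image_sub_constGamble_mem_optionSetsOf_iff [DecidableEq (Gamble X)]
    {D : ArchimedeanOptions X} {A : Finset (Gamble X)} {ε : ℝ} :
    A.image (fun f => f - constGamble X ε) ∈ optionSetsOf D.carrier ↔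
      ∃ f ∈ A, ε < lowerPrevision D.carrier f := by
  simp only [D.isArchimedean.lt_lowerPrevision_iff]
  exact Finset.exists_mem_image

end Nonempty

end ArchimedeanOptions

section InteriorCones

variable {X : Type*}

/-- The options that remain in `S` after subtracting some positive constant, which is the interior
of `S` if `S` is a cone that contains the non-negative gambles. It turns such a cone into an
Archimedean set of desirable options. -/
def archInterior (S : Set (Gamble X)) : Set (Gamble X) :=
  {f | ∃ ε : ℝ, 0 < ε ∧ f - constGamble X ε ∈ S}

theorem archInterior_mono {S T : Set (Gamble X)} (h : S ⊆ T) : archInterior S ⊆ archInterior T :=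
  fun _ ⟨ε, hε, hf⟩ => ⟨ε, hε, h hf⟩

theorem isArchimedeanOptions_archInterior {P : PointedCone ℝ (Gamble X)}
    (hpos : PointedCone.positive ℝ (Gamble X) ≤ P) (h0 : 0 ∉ archInterior (P : Set (Gamble X))) :
    IsArchimedeanOptions (archInterior (P : Set (Gamble X))) where
  coherent :=
    { zero_notMem := h0
      pos_subset := fun f hf => ⟨_, hf, hpos (sub_nonneg.2 (constGamble_iInf_le f))⟩
      cone := by
        rintro f ⟨ε, hε, hf⟩ g ⟨δ, hδ, hg⟩ l m ⟨hl, hm, hlm⟩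
        refine ⟨l * ε + m * δ, ?_, ?_⟩
        · rcases hl.eq_or_lt with rfl | hl
          · rw [zero_add] at hlm
            positivity
          · positivity
        · have hsum := P.add_mem (P.smul_mem hl hf) (P.smul_mem hm hg)
          rwa [smul_sub, smul_sub, sub_add_sub_comm, ← constGamble_mul, ← constGamble_mul,
            ← constGamble_add] at hsum }
  arch := by
    rintro f ⟨ε, hε, hf⟩
    refine ⟨ε / 2, half_pos hε, ε / 2, half_pos hε, ?_⟩
    rwa [sub_sub, ← constGamble_add, add_halves]

end InteriorCones

section CoherentOptionSets

variable {X : Type*} {K : Set (Finset (Gamble X))}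

theorem IsCoherentOptionSets.iInter {ι : Type*} [Nonempty ι] {K : ι → Set (Finset (Gamble X))}
    (h : ∀ i, IsCoherentOptionSets (K i)) : IsCoherentOptionSets (⋂ i, K i) where
  erase_zero A hA := Set.mem_iInter.2 fun i => (h i).erase_zero A (Set.mem_iInter.1 hA i)
  zero_notMem h0 := ‹Nonempty ι›.elim fun i => (h i).zero_notMem (Set.mem_iInter.1 h0 i)
  pos f hf := Set.mem_iInter.2 fun i => (h i).pos f hf
  cone A₁ h₁ A₂ h₂ l m hlm := Set.mem_iInter.2 fun i =>
    (h i).cone A₁ (Set.mem_iInter.1 h₁ i) A₂ (Set.mem_iInter.1 h₂ i) l m hlm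
  mono A₁ h₁ A₂ hA := Set.mem_iInter.2 fun i => (h i).mono A₁ (Set.mem_iInter.1 h₁ i) A₂ hA

theorem IsCoherentOptionSets.nonempty [Nonempty X] (hK : IsCoherentOptionSets K) : K.Nonempty :=
  ⟨_, hK.pos _ (constGamble_mem_positiveGambles one_pos)⟩

theorem IsCoherentOptionSets.empty_notMem (hK : IsCoherentOptionSets K) : ∅ ∉ K := fun h =>
  hK.zero_notMem (hK.mono _ h _ (Finset.empty_subset _))

/-- The extension of `K` to possibly infinite sets of options: those that include some option set
in `K`. It allows the cone axiom to be applied to sets described by a property. -/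
def infiniteExtension (K : Set (Finset (Gamble X))) : Set (Set (Gamble X)) :=
  {T | ∃ C ∈ K, (C : Set (Gamble X)) ⊆ T}

theorem IsCoherentOptionSets.mem_of_insert_zero_mem_infiniteExtension
    (hK : IsCoherentOptionSets K) {B : Finset (Gamble X)}
    (hB : insert 0 (B : Set (Gamble X)) ∈ infiniteExtension K) : B ∈ K := by
  classical
  obtain ⟨C, hC, hCB⟩ := hB
  refine hK.mono _ (hK.erase_zero C hC) B fun f hf => ?_
  exact (hCB (Finset.mem_of_mem_erase hf)).resolve_left (Finset.ne_of_mem_erase hf)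

theorem IsCoherentOptionSets.mem_infiniteExtension_of_forall₂ (hK : IsCoherentOptionSets K)
    {A₁ A₂ : Finset (Gamble X)} {T : Set (Gamble X)} (h₁ : A₁ ∈ K) (h₂ : A₂ ∈ K)
    (h : ∀ f ∈ A₁, ∀ g ∈ A₂, ∃ l m : ℝ, PosPair l m ∧ l • f + m • g ∈ T) :
    T ∈ infiniteExtension K := by
  classical
  choose! l m hlm hT using h
  refine ⟨_, hK.cone A₁ h₁ A₂ h₂ l m hlm, fun v hv => ?_⟩
  obtain ⟨⟨f, g⟩, hfg, rfl⟩ := Finset.mem_image.1 hv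
  obtain ⟨hf, hg⟩ := Finset.mem_product.1 hfg
  exact hT f hf g hg

theorem IsCoherentOptionSets.mem_infiniteExtension_of_forall (hK : IsCoherentOptionSets K)
    {A : Finset (Gamble X)} {T : Set (Gamble X)} (hA : A ∈ K)
    (h : ∀ f ∈ A, {c | ∃ l m : ℝ, PosPair l m ∧ l • f + m • c ∈ T} ∈ infiniteExtension K) :
    T ∈ infiniteExtension K := by
  classical
  -- The elements of `A` are absorbed into `T` one at a time.
  suffices key : ∀ S ⊆ A, (S ∪ T : Set (Gamble X)) ∈ infiniteExtension K →
      T ∈ infiniteExtension K from key A subset_rfl ⟨A, hA, Set.subset_union_left⟩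
  intro S
  induction S using Finset.induction_on with
  | empty => simp
  | insert f S _ ih =>
    rintro hSA ⟨C, hC, hCT⟩
    rw [Finset.insert_subset_iff] at hSA
    obtain ⟨C', hC', hC'T⟩ := h f hSA.1
    refine ih hSA.2 (hK.mem_infiniteExtension_of_forall₂ hC hC' fun g hg c hc => ?_)
    by_cases hgf : g = f
    · obtain ⟨l, m, hlm, hT⟩ := hC'T hc
      exact ⟨l, m, hlm, Or.inr (hgf ▸ hT)⟩
    · refine ⟨1, 0, ⟨zero_le_one, le_rfl, by norm_num⟩, ?_⟩
      simpa [hgf] using hCT hg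

end CoherentOptionSets

section CompatibleCones

variable {X : Type*} {K : Set (Finset (Gamble X))} {Z : Set (Gamble X)}
  {P : PointedCone ℝ (Gamble X)}

/-- The options whose addition to the cone `P` makes its interior meet `Z`, the options to be
avoided. -/
def obstructions (Z : Set (Gamble X)) (P : PointedCone ℝ (Gamble X)) : Set (Gamble X) :=
  {c | (archInterior (P ⊔ PointedCone.hull ℝ {c} : PointedCone ℝ (Gamble X)) ∩ Z).Nonempty}

/-- A cone `P` is compatible with `K` relative to a set `Z` of options to be avoided if each option
set in `K` has an element that can be added to `P` while its interior avoids `Z`. -/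
def IsCompatibleCone (K : Set (Finset (Gamble X))) (Z : Set (Gamble X))
    (P : PointedCone ℝ (Gamble X)) : Prop :=
  obstructions Z P ∉ infiniteExtension K

theorem IsCompatibleCone.disjoint (hP : IsCompatibleCone K Z P) (hK : K.Nonempty) :
    Disjoint (archInterior (P : Set (Gamble X))) Z := by
  refine Set.disjoint_iff_inter_eq_empty.2 (Set.not_nonempty_iff_eq_empty.1 fun hPZ => ?_)
  obtain ⟨C, hC⟩ := hK
  exact hP ⟨C, hC, fun c _ => hPZ.mono (Set.inter_subset_inter_left Z
    (archInterior_mono (SetLike.coe_subset_coe.2 le_sup_left)))⟩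

theorem IsCompatibleCone.exists_sup_hull_singleton (hP : IsCompatibleCone K Z P)
    (hK : IsCoherentOptionSets K) {A : Finset (Gamble X)} (hA : A ∈ K) :
    ∃ f ∈ A, IsCompatibleCone K Z (P ⊔ PointedCone.hull ℝ {f}) := by
  by_contra! h
  refine hP (hK.mem_infiniteExtension_of_forall hA fun f hf => ?_)
  obtain ⟨C, hC, hCZ⟩ := not_not.1 (h f hf)
  refine ⟨C, hC, fun c hc => ?_⟩
  obtain ⟨z, ⟨ε, hε, hz⟩, hzZ⟩ := hCZ hc
  obtain ⟨l, m, hlm, hz'⟩ := exists_posPair_mem_sup_hull_singleton hz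
  exact ⟨l, m, hlm, z, ⟨ε, hε, hz'⟩, hzZ⟩

variable [Nonempty X]

theorem IsCoherentOptionSets.isCompatibleCone_positive (hK : IsCoherentOptionSets K)
    {B : Finset (Gamble X)} (hB : B ∉ K) :
    IsCompatibleCone K (insert 0 (B : Set (Gamble X))) (PointedCone.positive ℝ (Gamble X)) := by
  rintro ⟨C, hC, hCB⟩
  refine hB (hK.mem_of_insert_zero_mem_infiniteExtension
    (hK.mem_infiniteExtension_of_forall hC fun f hf => ?_))
  obtain ⟨z, ⟨ε, hε, hz⟩, hzB⟩ := hCB hf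
  obtain ⟨p, hp, l, hl, hpz⟩ := mem_sup_hull_singleton_iff.1 hz
  refine ⟨_, hK.pos _ (add_constGamble_mem_positiveGambles hp hε), fun c hc => ?_⟩
  obtain rfl := Finset.mem_singleton.1 hc
  refine ⟨l, 1, ⟨hl, zero_le_one, by positivity⟩, ?_⟩
  have hz_eq : l • f + (1 : ℝ) • (p + constGamble X ε) = z := by
    rw [one_smul, ← add_assoc, add_comm (l • f), hpz, sub_add_cancel]
  rwa [hz_eq]

theorem IsCoherentOptionSets.exists_isCompatibleCone (hK : IsCoherentOptionSets K)
    {B : Finset (Gamble X)} (hB : B ∉ K) (𝒜 : Finset K) :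
    ∃ P : PointedCone ℝ (Gamble X), PointedCone.positive ℝ (Gamble X) ≤ P ∧
      IsCompatibleCone K (insert 0 (B : Set (Gamble X))) P ∧ ∀ A ∈ 𝒜, ∃ f ∈ A.1, f ∈ P := by
  classical
  induction 𝒜 using Finset.induction_on with
  | empty => exact ⟨_, le_rfl, hK.isCompatibleCone_positive hB, by simp⟩
  | insert A 𝒜 _ ih =>
    obtain ⟨P, hpos, hP, h𝒜⟩ := ih
    obtain ⟨f, hfA, hPf⟩ := hP.exists_sup_hull_singleton hK A.2
    refine ⟨_, hpos.trans le_sup_left, hPf, Finset.forall_mem_insert _ _ _ |>.2 ⟨?_, ?_⟩⟩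
    · exact ⟨f, hfA, Submodule.mem_sup_right (Submodule.mem_span_singleton_self f)⟩
    · intro A' hA'
      obtain ⟨g, hgA', hg⟩ := h𝒜 A' hA'
      exact ⟨g, hgA', Submodule.mem_sup_left hg⟩

end CompatibleCones

section Separation

variable {X : Type*} [Nonempty X] {K : Set (Finset (Gamble X))}

open ArchimedeanOptions

theorem IsCoherentOptionSets.exists_mem_weaklyAccepting_of_finset (hK : IsCoherentOptionSets K)
    {B : Finset (Gamble X)} (hB : B ∉ K) (𝒜 : Finset K) :
    ∃ D : ArchimedeanOptions X, B ∉ optionSetsOf D.carrier ∧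
      ∀ A ∈ 𝒜, D ∈ weaklyAccepting A.1 := by
  obtain ⟨P, hpos, hP, h𝒜⟩ := hK.exists_isCompatibleCone hB 𝒜
  have hdisj := Set.disjoint_left.1 (hP.disjoint hK.nonempty)
  have hD := isArchimedeanOptions_archInterior hpos fun h0 => hdisj h0 (Set.mem_insert 0 _)
  refine ⟨⟨_, hD⟩, fun ⟨f, hfB, hf⟩ => hdisj hf (Set.mem_insert_of_mem 0 hfB), fun A hA => ?_⟩
  obtain ⟨f, hfA, hf⟩ := h𝒜 A hA
  refine ⟨f, hfA, le_of_forall_lt fun a ha => hD.lt_lowerPrevision_iff.2 ⟨-a, neg_pos.2 ha, ?_⟩⟩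
  simpa [constGamble_neg] using hf

theorem IsCoherentOptionSets.exists_forall_mem_weaklyAccepting (hK : IsCoherentOptionSets K)
    {B : Finset (Gamble X)} (hB : B ∉ K) :
    ∃ D : ArchimedeanOptions X, B ∉ optionSetsOf D.carrier ∧ ∀ A ∈ K, D ∈ weaklyAccepting A := by
  obtain ⟨D, hDB, hDK⟩ := (isClosed_setOf_notMem_optionSetsOf B).isCompact.inter_iInter_nonempty
    (fun A : K => weaklyAccepting A.1) (fun A => isClosed_weaklyAccepting A.1) fun 𝒜 => by
      obtain ⟨D, hDB, hD𝒜⟩ := hK.exists_mem_weaklyAccepting_of_finset hB 𝒜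
      exact ⟨D, hDB, Set.mem_iInter₂.2 hD𝒜⟩
  exact ⟨D, hDB, fun A hA => Set.mem_iInter.1 hDK ⟨A, hA⟩⟩

namespace IsArchimedeanOptionSets

theorem subset_optionSetsOf_iff (hK : IsArchimedeanOptionSets K) {D : ArchimedeanOptions X} :
    K ⊆ optionSetsOf D.carrier ↔ ∀ A ∈ K, D ∈ weaklyAccepting A := by
  classical
  refine ⟨fun h A hA => ?_, fun h A hA => ?_⟩
  · obtain ⟨f, hfA, hf⟩ := mem_optionSetsOf_iff_lowerPrevision_pos.1 (h hA)
    exact ⟨f, hfA, hf.le⟩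
  · obtain ⟨ε, hε, hAε⟩ := hK.arch A hA
    obtain ⟨g, hg, hgD⟩ := h _ hAε
    obtain ⟨f, hfA, rfl⟩ := Finset.mem_image.1 hg
    rw [D.isArchimedean.isCoherentLowerPrevision.map_sub_const, sub_nonneg] at hgD
    exact mem_optionSetsOf_iff_lowerPrevision_pos.2 ⟨f, hfA, hε.trans_le hgD⟩

theorem isClosed_setOf_subset_optionSetsOf (hK : IsArchimedeanOptionSets K) :
    IsClosed {D : ArchimedeanOptions X | K ⊆ optionSetsOf D.carrier} := by
  simp only [hK.subset_optionSetsOf_iff, Set.ofPred_forall]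
  exact isClosed_biInter fun A _ => isClosed_weaklyAccepting A

theorem exists_subset_optionSetsOf (hK : IsArchimedeanOptionSets K) {B : Finset (Gamble X)}
    (hB : B ∉ K) :
    ∃ D : ArchimedeanOptions X, K ⊆ optionSetsOf D.carrier ∧ B ∉ optionSetsOf D.carrier := by
  obtain ⟨D, hDB, hDK⟩ := hK.coherent.exists_forall_mem_weaklyAccepting hB
  exact ⟨D, hK.subset_optionSetsOf_iff.2 hDK, hDB⟩

theorem isClosedRepresentation (hK : IsArchimedeanOptionSets K) :
    IsClosedRepresentation K {D : ArchimedeanOptions X | K ⊆ optionSetsOf D.carrier} := by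
  refine ⟨?_, hK.isClosed_setOf_subset_optionSetsOf, ?_⟩
  · obtain ⟨D, hD, -⟩ := hK.exists_subset_optionSetsOf hK.coherent.empty_notMem
    exact ⟨D, hD⟩
  · refine Set.Subset.antisymm (Set.subset_iInter₂ fun D hD => hD) fun B hB => ?_
    by_contra hBK
    obtain ⟨D, hKD, hBD⟩ := hK.exists_subset_optionSetsOf hBK
    exact hBD (Set.mem_iInter₂.1 hB D hKD)

end IsArchimedeanOptionSets

theorem ArchimedeanOptions.exists_forall_lt_lowerPrevision_of_isCompact
    {𝒟 : Set (ArchimedeanOptions X)} (h𝒟 : IsCompact 𝒟) {A : Finset (Gamble X)} (hA : A.Nonempty)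
    (h : ∀ D ∈ 𝒟, A ∈ optionSetsOf D.carrier) :
    ∃ ε > 0, ∀ D ∈ 𝒟, ∃ f ∈ A, ε < lowerPrevision D.carrier f := by
  have hcont : Continuous fun D : ArchimedeanOptions X =>
      A.sup' hA fun f => lowerPrevision D.carrier f :=
    Continuous.finset_sup'_apply hA fun f _ => continuous_lowerPrevision f
  obtain ⟨δ, hδ, hmin⟩ := h𝒟.exists_forall_le' hcont.continuousOn (a := 0) fun D hD =>
    (Finset.lt_sup'_iff hA).2 (mem_optionSetsOf_iff_lowerPrevision_pos.1 (h D hD))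
  exact ⟨δ / 2, half_pos hδ, fun D hD =>
    (Finset.lt_sup'_iff hA).1 ((half_lt_self hδ).trans_le (hmin D hD))⟩

theorem IsClosedRepresentation.isArchimedeanOptionSets {𝒟 : Set (ArchimedeanOptions X)}
    (h : IsClosedRepresentation K 𝒟) : IsArchimedeanOptionSets K := by
  classical
  obtain ⟨hne, hclosed, rfl⟩ := h
  have := hne.to_subtype
  have hcoherent : IsCoherentOptionSets (⋂ D ∈ 𝒟, optionSetsOf D.carrier) := by
    rw [Set.biInter_eq_iInter]
    exact .iInter fun D : 𝒟 => D.1.isArchimedean.coherent.isCoherentOptionSets_optionSetsOf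
  refine ⟨hcoherent, fun A hA => ?_⟩
  have hA_nonempty : A.Nonempty :=
    Finset.nonempty_iff_ne_empty.2 fun hA' => hcoherent.empty_notMem (hA' ▸ hA)
  obtain ⟨ε, hε, hlt⟩ :=
    exists_forall_lt_lowerPrevision_of_isCompact hclosed.isCompact hA_nonempty
      (Set.mem_iInter₂.1 hA)
  exact ⟨ε, hε, Set.mem_iInter₂.2 fun D hD =>
    image_sub_constGamble_mem_optionSetsOf_iff.2 (hlt D hD)⟩

end Separation

theorem mainTheorem4 {X : Type*} [Nonempty X] (K : Set (Finset (Gamble X))) :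
    (IsArchimedeanOptionSets K ↔
      ∃ 𝒟 : Set (ArchimedeanOptions X), IsClosedRepresentation K 𝒟) ∧
    (IsArchimedeanOptionSets K →
      IsGreatest {𝒟 : Set (ArchimedeanOptions X) | IsClosedRepresentation K 𝒟}
        {D : ArchimedeanOptions X | K ⊆ optionSetsOf D.carrier}) := by
  refine ⟨⟨fun hK => ⟨_, hK.isClosedRepresentation⟩,
    fun ⟨_, h𝒟⟩ => h𝒟.isArchimedeanOptionSets⟩, fun hK => ⟨hK.isClosedRepresentation, ?_⟩⟩
  rintro 𝒟 ⟨-, -, rfl⟩ D hD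
  exact Set.biInter_subset_of_mem hD
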